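/- Let $0\le m\le m'\le n$ be integers, $[n]=\{1,\dots,n\}$, and let $C_m^{m'}=\{S\subseteq[n]: m\le |S|\le m'\}$ be the truncated Boolean cube. Let $\Gamma_{n,m'}$ be the grid, i.e. the directed graph with vertices $v_{pq}$ ($1\le p\le n$, $1\le q\le m'$) and edges from $v_{pq}$ to $v_{p-1,q}$ and from $v_{pq}$ to $v_{p,q+1}$ (whenever these vertices exist). The vertices $s_p=v_{p1}$ ($p=1,\dots,n$) are the sources and the vertices $t_q=v_{1q}$ ($q=1,\dots,m'$) are the sinks. A flow is a finite collection $\mathcal F$ of directed paths of $\Gamma_{n,m'}$, each beginning at a source and ending at a sink; it is admissible if its paths are pairwise vertex-disjoint and the sinks at which they end are exactly $t_1,\dots,t_{|\mathcal F|}$. Let $W=(w_{pq})$ be a real $n\times m'$ matrix, regarded as the vertex weighting $w(v_{pq})=w_{pq}$. The weight of a path is the sum of the weights of its vertices, and the weight $w(\mathcal F)$ of a flow is the sum of the weights of its paths. For $S\subseteq[n]$ with $|S|\le m'$ put $$f_w(S)=\max w(\mathcal F),$$ the maximum being over all admissible flows $\mathcal F$ in $\Gamma_{n,m'}$ whose set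 of beginning vertices is $\{s_p:p\in S\}$. Then this maximum exists for every $S\subseteq[n]$ with $|S|\le m'$, $f_w(\emptyset)=0$, and $f_w$ is a tropical Plücker function on $C_m^{m'}$. That is, writing $Xi\ldots j$ for $X\cup\{i,\ldots,j\}$: (TP3) for all $i<j<k$ in $[n]$ and $X\subseteq[n]\setminus\{i,j,k\}$ such that the six sets below belong to $C_m^{m'}$, $$f_w(Xik)+f_w(Xj)=\max\{f_w(Xij)+f_w(Xk),\ f_w(Xi)+f_w(Xjk)\};$$ (TP4) for all $i<j<k<\ell$ in $[n]$ and $X\subseteq[n]\setminus\{i,j,k,\ell\}$ such that the six sets below belong to $C_m^{m'}$, $$f_w(Xik)+f_w(Xj\ell)=\max\{f_w(Xij)+f_w(Xk\ell),\ f_w(Xi\ell)+f_w(Xjk)\}.$$ -/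

import Mathlib

/-- The truncated Boolean cube `C_m^{m'}`: the sets `S ⊆ [n]` with `m ≤ |S| ≤ m'`.
The ground set `[n]` is `Fin n`, so that `p ∈ [n]` is the index `p - 1`. -/
def truncatedCube (n m m' : ℕ) : Set (Finset (Fin n)) :=
  {S | m ≤ S.card ∧ S.card ≤ m'}

/-- `f` is a tropical Plücker function on the family `C` of subsets of `[n]`: it satisfies all
TP3-relations and all TP4-relations whose six arguments belong to `C`.
Only the values of `f` on `C` matter. -/
structure IsTropicalPluckerOn {n : ℕ} (C : Set (Finset (Fin n)))
    (f : Finset (Fin n) → ℝ) : Prop where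
  tp3 : ∀ (X : Finset (Fin n)) (i j k : Fin n), i < j → j < k →
    i ∉ X → j ∉ X → k ∉ X →
    insert i (insert k X) ∈ C → insert j X ∈ C →
    insert i (insert j X) ∈ C → insert k X ∈ C →
    insert i X ∈ C → insert j (insert k X) ∈ C →
    f (insert i (insert k X)) + f (insert j X) =
      max (f (insert i (insert j X)) + f (insert k X))
        (f (insert i X) + f (insert j (insert k X)))
  tp4 : ∀ (X : Finset (Fin n)) (i j k l : Fin n), i < j → j < k → k < l →
    i ∉ X → j ∉ X → k ∉ X → l ∉ X →
    insert i (insert k X) ∈ C → insert j (insert l X) ∈ C →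
    insert i (insert j X) ∈ C → insert k (insert l X) ∈ C →
    insert i (insert l X) ∈ C → insert j (insert k X) ∈ C →
    f (insert i (insert k X)) + f (insert j (insert l X)) =
      max (f (insert i (insert j X)) + f (insert k (insert l X)))
        (f (insert i (insert l X)) + f (insert j (insert k X)))

/-- The grid `Γ_{n,m'}` with vertices `v_{pq} = (p, q)`; its edges go from `(p, q)` to
`(p - 1, q)` and to `(p, q + 1)`. -/
def grid (n m' : ℕ) : Digraph (Fin n × Fin m') where
  Adj u v := ((v.1 : ℕ) + 1 = u.1 ∧ v.2 = u.2) ∨ (v.1 = u.1 ∧ (v.2 : ℕ) = u.2 + 1)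

/-- A directed path of the grid, given by the nonempty list of its vertices in order.
(The grid is acyclic, so no vertex can be repeated.) -/
structure GridPath (n m' : ℕ) where
  verts : List (Fin n × Fin m')
  ne_nil : verts ≠ []
  chain : verts.IsChain (grid n m').Adj

/-- The beginning of a path. -/
def GridPath.first {n m' : ℕ} (P : GridPath n m') : Fin n × Fin m' := P.verts.head P.ne_nil

/-- The end of a path. -/
def GridPath.last {n m' : ℕ} (P : GridPath n m') : Fin n × Fin m' := P.verts.getLast P.ne_nil

/-- The weight of a path: the sum of the weights of its vertices. -/
def GridPath.weight {n m' : ℕ} (W : Matrix (Fin n) (Fin m') ℝ) (P : GridPath n m') : ℝ :=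
  (P.verts.map fun v => W v.1 v.2).sum

/-- The source `s_p` is the vertex `v_{p,1}` (second coordinate `0` in `Fin m'`). -/
def IsSource {n m' : ℕ} (v : Fin n × Fin m') : Prop := (v.2 : ℕ) = 0

/-- The sink `t_q` is the vertex `v_{1,q}` (first coordinate `0` in `Fin n`). -/
def IsSink {n m' : ℕ} (v : Fin n × Fin m') : Prop := (v.1 : ℕ) = 0

/-- A finite collection of paths of the grid is a flow if each of its paths begins at a source
and ends at a sink. -/
def IsFlow {n m' : ℕ} (F : Finset (GridPath n m')) : Prop :=
  ∀ P ∈ F, IsSource P.first ∧ IsSink P.last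

/-- An admissible flow: its paths are pairwise vertex-disjoint, and the set of sinks at which they
end is `{t_1, …, t_{|F|}}`. -/
structure IsAdmissible {n m' : ℕ} (F : Finset (GridPath n m')) : Prop where
  flow : IsFlow F
  disjoint : ∀ P ∈ F, ∀ Q ∈ F, P ≠ Q → P.verts.Disjoint Q.verts
  sinks : GridPath.last '' (F : Set (GridPath n m')) =
    {v : Fin n × Fin m' | IsSink v ∧ (v.2 : ℕ) < F.card}

/-- The collection of paths `F` begins at the set `{s_p : p ∈ S}`. -/
def BeginsAt {n m' : ℕ} (F : Finset (GridPath n m')) (S : Finset (Fin n)) : Prop :=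
  GridPath.first '' (F : Set (GridPath n m')) = {v : Fin n × Fin m' | IsSource v ∧ v.1 ∈ S}

/-- The weight of a flow: the sum of the weights of its paths. -/
def flowWeight {n m' : ℕ} (W : Matrix (Fin n) (Fin m') ℝ) (F : Finset (GridPath n m')) : ℝ :=
  ∑ P ∈ F, P.weight W

/-- The weights of the admissible flows that begin at `{s_p : p ∈ S}`. -/
def admissibleWeights {n m' : ℕ} (W : Matrix (Fin n) (Fin m') ℝ) (S : Finset (Fin n)) : Set ℝ :=
  {x | ∃ F : Finset (GridPath n m'), IsAdmissible F ∧ BeginsAt F S ∧ flowWeight W F = x}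

/-- The function `f_w`, the largest weight of an admissible flow that begins at `{s_p : p ∈ S}`. -/
noncomputable def flowFunction {n m' : ℕ} (W : Matrix (Fin n) (Fin m') ℝ)
    (S : Finset (Fin n)) : ℝ :=
  sSup (admissibleWeights W S)

/-! Replace each vertex weight `w` by the positive variable `exp (θ w)`. The generating function of
the admissible flows from `S` then equals the minor of the path matrix with rows `S` and the first
`|S|` columns. Such flag minors satisfy three-term Plücker relations whose terms all have
coefficient `+1`. Each minor is a sum of `exp (θ a)` over the flow weights `a`, so nothing cancels,
and comparing growth for large `θ` turns products into sums and sums into maxima. The identity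
between flows and minors is proved by removing one column of the grid at a time. Row operations
expand the minor over interlacing sequences (`flowDet_succ`), and cutting disjoint paths where they
leave the first column gives the same recursion (`exists_peel`, `exists_unpeel`). The common
recursion is `flowWeights`. The algebra is in `flagMinor_plucker_three` and
`flagMinor_plucker_four`, the limit in `exists_le_of_sum_exp_le`. -/

/-! ### Minors of the path matrix and their expansion along a grid column. -/

open Finset in
/-- The generating function of the paths of the grid from `(p, c)` to `(0, c + q)`, each path being
counted with the product of the values of `x` at its vertices. -/
def pathSum {n : ℕ} (x : Fin n → ℕ → ℝ) : ℕ → ℕ → Fin n → ℝ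
  | 0, c, p => ∏ t ∈ Iic p, x t c
  | q + 1, c, p => ∑ r ∈ Iic p, (∏ t ∈ Icc r p, x t c) * pathSum x q (c + 1) r

/-- The minor of the path matrix with rows `s` and the first `k` columns, for paths that begin in
column `c`. -/
def flowDet {n : ℕ} (x : Fin n → ℕ → ℝ) (k c : ℕ) (s : Fin k → Fin n) : ℝ :=
  (Matrix.of fun i j : Fin k => pathSum x j c (s i)).det

/-- The sequences `r` that interlace with `s`. -/
def interlacing {n k : ℕ} (s : Fin (k + 1) → Fin n) : Finset (Fin k → Fin n) :=
  Fintype.piFinset fun j => Finset.Ioc (s j.castSucc) (s j.succ)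

theorem mem_interlacing {n k : ℕ} {s : Fin (k + 1) → Fin n} {r : Fin k → Fin n} :
    r ∈ interlacing s ↔ ∀ j, s j.castSucc < r j ∧ r j ≤ s j.succ := by
  simp [interlacing, Fintype.mem_piFinset]

theorem strictMono_of_mem_interlacing {n k : ℕ} {s : Fin (k + 1) → Fin n} {r : Fin k → Fin n}
    (hs : StrictMono s) (hr : r ∈ interlacing s) : StrictMono r := by
  rw [mem_interlacing] at hr
  intro i j hij
  refine (hr i).2.trans_lt (lt_of_le_of_lt (hs.monotone ?_) (hr j).1)
  rw [Fin.le_def]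
  simpa using Nat.succ_le_of_lt (Fin.lt_def.1 hij)

-- A path is determined by the row `r` where it leaves column `c` and by what follows. Subtracting
-- from each row a multiple of the previous one cancels all exits at or below index `s i.castSucc`,
-- so only interlacing exits remain and no signs occur.
open Finset in
theorem flowDet_succ {n : ℕ} (x : Fin n → ℕ → ℝ) (k c : ℕ) (s : Fin (k + 1) → Fin n)
    (hs : StrictMono s) :
    flowDet x (k + 1) c s = ∑ r ∈ interlacing s,
      ((∏ t ∈ Iic (s 0), x t c) * ∏ j : Fin k, ∏ t ∈ Icc (r j) (s j.succ), x t c) *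
        flowDet x k (c + 1) r := by
  have hlt : ∀ i : Fin k, s i.castSucc < s i.succ := fun i => hs Fin.castSucc_lt_succ
  have hIic : ∀ i : Fin k, Iic (s i.succ) = Ioc (s i.castSucc) (s i.succ) ∪ Iic (s i.castSucc) := by
    intro i; ext t; have := hlt i; simp only [mem_Iic, mem_union, mem_Ioc]
    constructor
    · intro h; rcases le_or_gt t (s i.castSucc) with h' | h'
      · exact Or.inr h'
      · exact Or.inl ⟨h', h⟩
    · rintro (h | h)
      · exact h.2
      · exact h.trans this.le
  have hdisj : ∀ i : Fin k, Disjoint (Ioc (s i.castSucc) (s i.succ)) (Iic (s i.castSucc)) := by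
    intro i; rw [Finset.disjoint_left]; intro t ht; simp only [mem_Ioc, mem_Iic] at *
    exact not_le.2 ht.1
  -- What remains of row `i.succ` after the subtraction, without its first entry, which becomes
  -- zero.
  let row : Fin k → Fin k → ℝ := fun i q => ∑ r ∈ Ioc (s i.castSucc) (s i.succ),
    (∏ t ∈ Icc r (s i.succ), x t c) * pathSum x q (c + 1) r
  let N : Matrix (Fin (k + 1)) (Fin (k + 1)) ℝ := Matrix.of <|
    Fin.cons (fun j => pathSum x j c (s 0)) fun i => Fin.cons 0 (row i)
  have h1 : flowDet x (k + 1) c s = N.det := by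
    refine Matrix.det_eq_of_forall_row_eq_smul_add_pred
      (fun i => ∏ t ∈ Ioc (s i.castSucc) (s i.succ), x t c) (fun j => by simp [N]) ?_
    intro i j
    refine Fin.cases ?_ (fun q => ?_) j
    · simp only [N, Matrix.of_apply, Fin.cons_succ, Fin.cons_zero, Fin.val_zero, pathSum]
      rw [hIic i, prod_union (hdisj i), zero_add]
    · simp only [N, row, Matrix.of_apply, Fin.cons_succ, Fin.val_succ, pathSum]
      rw [hIic i, sum_union (hdisj i), mul_sum]
      congr 1
      refine sum_congr rfl fun r hr => ?_
      rw [← mul_assoc]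
      congr 1
      have hr' : r ≤ s i.castSucc := by simpa using hr
      have : Icc r (s i.succ) = Ioc (s i.castSucc) (s i.succ) ∪ Icc r (s i.castSucc) := by
        ext t; simp only [mem_Icc, mem_union, mem_Ioc]
        have := hlt i
        constructor
        · rintro ⟨h, h'⟩
          rcases le_or_gt t (s i.castSucc) with h'' | h''
          · exact Or.inr ⟨h, h''⟩
          · exact Or.inl ⟨h'', h'⟩
        · rintro (h | h)
          · exact ⟨hr'.trans h.1.le, h.2⟩
          · exact ⟨h.1, h.2.trans this.le⟩
      rw [this, prod_union]
      refine (hdisj i).mono_right fun t ht => ?_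
      simp only [mem_Icc, mem_Iic] at *
      exact ht.2
  have h2 : N.det = (∏ t ∈ Iic (s 0), x t c) * (Matrix.of row).det := by
    rw [Matrix.det_succ_column_zero, Fin.sum_univ_succ]
    rw [sum_eq_zero (fun i _ => by simp [N])]
    simp only [N, Matrix.of_apply, Fin.cons_zero, Fin.val_zero, pathSum, pow_zero, one_mul,
      add_zero]
    congr 2
  have h3 : (Matrix.of row).det = ∑ r ∈ interlacing s,
      (∏ j : Fin k, ∏ t ∈ Icc (r j) (s j.succ), x t c) * flowDet x k (c + 1) r := by
    have e : Matrix.of row = fun i => ∑ r ∈ Ioc (s i.castSucc) (s i.succ),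
        (∏ t ∈ Icc r (s i.succ), x t c) • fun q : Fin k => pathSum x q (c + 1) r := by
      ext i q; simp [row, Finset.sum_apply]
    -- Multilinearity chooses an exit in each row independently; the choices are exactly the
    -- interlacing sequences.
    have := (Matrix.detRowAlternating (n := Fin k) (R := ℝ)).toMultilinearMap.map_sum_finset
      (fun (i : Fin k) (r : Fin n) =>
        (∏ t ∈ Icc r (s i.succ), x t c) • fun q : Fin k => pathSum x q (c + 1) r)
      (fun i => Ioc (s i.castSucc) (s i.succ))
    rw [e]
    refine this.trans (sum_congr rfl fun r _ => ?_)
    rw [MultilinearMap.map_smul_univ]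
    rfl
  rw [h1, h2, h3, mul_sum]
  exact sum_congr rfl fun r _ => by ring

/-! ### Plücker relations for flag minors. -/

/-- A three-term Plücker relation. -/
theorem Matrix.det_vecCons_vecCons_plucker {d : ℕ} (X : Fin d → Fin (d + 2) → ℝ)
    (vi vj vk vl : Fin (d + 2) → ℝ)
    (h : (Matrix.of (Matrix.vecCons vi (Matrix.vecCons vk X))).det ≠ 0) :
    (Matrix.of (Matrix.vecCons vi (Matrix.vecCons vk X))).det *
        (Matrix.of (Matrix.vecCons vj (Matrix.vecCons vl X))).det =
      (Matrix.of (Matrix.vecCons vi (Matrix.vecCons vj X))).det *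
        (Matrix.of (Matrix.vecCons vk (Matrix.vecCons vl X))).det +
      (Matrix.of (Matrix.vecCons vi (Matrix.vecCons vl X))).det *
        (Matrix.of (Matrix.vecCons vj (Matrix.vecCons vk X))).det := by
  set D := Matrix.detRowAlternating (n := Fin (d + 2)) (R := ℝ)
  let B : (Fin (d + 2) → ℝ) → (Fin (d + 2) → ℝ) → ℝ :=
    fun a b => D (Matrix.vecCons a (Matrix.vecCons b X))
  have hD : ∀ a b, (Matrix.of (Matrix.vecCons a (Matrix.vecCons b X))).det = B a b :=
    fun _ _ => rfl
  simp only [hD] at h ⊢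
  have hswap : ∀ a b, B a b = - B b a := by
    intro a b
    have := D.map_swap (Matrix.vecCons b (Matrix.vecCons a X)) (i := 0) (j := 1) (by simp)
    rw [← this]
    simp only [B]
    congr 1
    ext i : 1
    refine Fin.cases (by simp) (fun i => Fin.cases (by simp) (fun i => ?_) i) i
    rw [Function.comp_apply, Equiv.swap_apply_of_ne_of_ne]
    · simp
    · exact Fin.succ_ne_zero _
    · intro h; exact Fin.succ_ne_zero i (Fin.succ_injective _ h)
  have hself : ∀ a, B a a = 0 := fun a => by linarith [hswap a a]
  -- As the determinant is nonzero, `vi`, `vk` and `X` form a basis; the components of `vj` along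
  -- `X` do not contribute to `B`.
  obtain ⟨α, β, hj⟩ : ∃ α β, ∀ b, B vj b = α * B vi b + β * B vk b := by
    set A := Matrix.of (Matrix.vecCons vi (Matrix.vecCons vk X))
    have hA : IsUnit A.det := isUnit_iff_ne_zero.2 h
    set c := Matrix.vecMul vj A⁻¹
    have hc : vj = ∑ i, c i • A i := by
      rw [← Matrix.vecMul_eq_sum, Matrix.vecMul_vecMul, Matrix.nonsing_inv_mul _ hA,
        Matrix.vecMul_one]
    refine ⟨c 0, c 1, fun b => ?_⟩
    let Lb : (Fin (d + 2) → ℝ) →ₗ[ℝ] ℝ :=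
      { toFun := fun a => B a b
        map_add' := fun x y => D.map_vecCons_add _ x y
        map_smul' := fun r x => D.map_vecCons_smul _ r x }
    have hX : ∀ i : Fin d, B (X i) b = 0 := fun i => D.map_eq_zero_of_eq _
      (i := 0) (j := i.succ.succ) (by simp) (Fin.succ_ne_zero _).symm
    have hB : B vj b = ∑ i, c i * B (A i) b := by
      change Lb vj = _
      rw [hc, map_sum]
      exact Finset.sum_congr rfl fun i _ => map_smul Lb _ _
    rw [hB, Fin.sum_univ_succ, Fin.sum_univ_succ, Finset.sum_eq_zero, add_zero]
    · rfl
    · intro i _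
      exact mul_eq_zero_of_right _ (hX i)
  have e1 := hj vl
  have e2 := hj vk
  have e3 := hj vi
  rw [hself, mul_zero, add_zero] at e2
  rw [hself, mul_zero, zero_add, hswap vj vi, hswap vk vi] at e3
  rw [e1, e2]
  have e4 : B vi vj = β * B vi vk := by linarith
  rw [e4]; ring

/-- In the increasing order, `a` stands at the position given by the number of elements of `S` below
it, and moving it to the front costs that many transpositions. -/
theorem AlternatingMap.map_orderEmbOfFin_insert {V : Type*} [AddCommGroup V] [Module ℝ V]
    {n d : ℕ} (f : V [⋀^Fin (d + 1)]→ₗ[ℝ] ℝ) (v : Fin n → V) {a : Fin n} {S : Finset (Fin n)}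
    (hS : S.card = d) (h : (insert a S).card = d + 1) :
    f (fun i => v ((insert a S).orderEmbOfFin h i)) =
      (-1) ^ (S.filter (· < a)).card * f (Matrix.vecCons (v a) fun i => v (S.orderEmbOfFin hS i)) := by
  set u := (insert a S).orderEmbOfFin h with hu
  obtain ⟨p, hp⟩ : a ∈ Set.range u := by rw [hu, Finset.range_orderEmbOfFin]; simp
  have hmem : ∀ i, i ≠ p → u i ∈ S := fun i hi => by
    have := Finset.orderEmbOfFin_mem (insert a S) h i
    rw [Finset.mem_insert] at this
    refine this.resolve_left fun h' => hi (u.injective ?_)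
    rw [hp]; exact h'
  have h1 : (fun i => u (p.succAbove i)) = S.orderEmbOfFin hS :=
    Finset.orderEmbOfFin_unique hS (fun i => hmem _ (Fin.succAbove_ne _ _))
      (u.strictMono.comp (Fin.strictMono_succAbove p))
  have h2 : (S.filter (· < a)).card = p := by
    have : S.filter (· < a) = (Finset.Iio p).map u.toEmbedding := by
      ext y
      simp only [Finset.mem_filter, Finset.mem_map, Finset.mem_Iio]
      constructor
      · rintro ⟨hy, hya⟩
        obtain ⟨i, hi⟩ : y ∈ Set.range u := by rw [hu, Finset.range_orderEmbOfFin]; simp [hy]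
        refine ⟨i, ?_, hi⟩
        rw [← hi, ← hp] at hya
        exact u.lt_iff_lt.1 hya
      · rintro ⟨i, hi, rfl⟩
        exact ⟨hmem i hi.ne, by rw [← hp]; exact u.lt_iff_lt.2 hi⟩
    rw [this, Finset.card_map, Fin.card_Iio]
  have h3 : (fun i => v (u i)) = p.insertNth (v a) fun i => v (S.orderEmbOfFin hS i) := by
    rw [Fin.eq_insertNth_iff]
    refine ⟨by rw [hp], ?_⟩
    ext i
    rw [← h1]
    rfl
  rw [h3, f.map_insertNth, h2]
  simp [zsmul_eq_mul]

/-- Since `a < b`, the element `b` does not count towards the sign of `a`. Each inserted element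
thus has a sign that depends on it and `S` alone, so all three products in a Plücker relation carry
the same sign. -/
theorem AlternatingMap.map_orderEmbOfFin_insert_insert {V : Type*} [AddCommGroup V] [Module ℝ V]
    {n d : ℕ} (f : V [⋀^Fin (d + 2)]→ₗ[ℝ] ℝ) (v : Fin n → V) {a b : Fin n} {S : Finset (Fin n)}
    (hab : a < b) (hb : b ∉ S) (hS : S.card = d)
    (h : (insert a (insert b S)).card = d + 2) :
    f (fun i => v ((insert a (insert b S)).orderEmbOfFin h i)) =
      (-1) ^ (S.filter (· < a)).card * (-1) ^ (S.filter (· < b)).card *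
        f (Matrix.vecCons (v a) (Matrix.vecCons (v b) fun i => v (S.orderEmbOfFin hS i))) := by
  have hb' : (insert b S).card = d + 1 := by rw [Finset.card_insert_of_notMem hb, hS]
  rw [AlternatingMap.map_orderEmbOfFin_insert f v hb' h, Finset.filter_insert,
    if_neg hab.not_gt]
  have := AlternatingMap.map_orderEmbOfFin_insert (f.curryLeft (v a)) v hS hb'
  simp only [AlternatingMap.curryLeft_apply_apply] at this
  rw [this, mul_assoc]

/-- The minor of the path matrix with the rows in `S` and the first `|S|` columns. -/
def flagMinor {n : ℕ} (x : Fin n → ℕ → ℝ) (S : Finset (Fin n)) : ℝ :=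
  flowDet x S.card 0 (S.orderEmbOfFin rfl)

theorem flagMinor_eq {n : ℕ} (x : Fin n → ℕ → ℝ) (S : Finset (Fin n)) {k : ℕ} (h : S.card = k) :
    flagMinor x S = flowDet x k 0 (S.orderEmbOfFin h) := by
  subst h; rfl

/-- The row `p` of the path matrix, cut off after `k` entries. -/
def pathRow {n : ℕ} (x : Fin n → ℕ → ℝ) (k : ℕ) (p : Fin n) : Fin k → ℝ :=
  fun j => pathSum x j 0 p

theorem flagMinor_insert {n : ℕ} (x : Fin n → ℕ → ℝ) {X : Finset (Fin n)} {a : Fin n}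
    (ha : a ∉ X) :
    flagMinor x (insert a X) = (-1) ^ (X.filter (· < a)).card *
      (Matrix.of (Matrix.vecCons (pathRow x (X.card + 1) a)
        fun i => pathRow x (X.card + 1) (X.orderEmbOfFin rfl i))).det := by
  have h : (insert a X).card = X.card + 1 := Finset.card_insert_of_notMem ha
  rw [flagMinor_eq x _ h]
  exact AlternatingMap.map_orderEmbOfFin_insert Matrix.detRowAlternating (pathRow x _) rfl h

theorem flagMinor_insert_insert {n : ℕ} (x : Fin n → ℕ → ℝ) {X : Finset (Fin n)} {a b : Fin n}
    (hab : a < b) (ha : a ∉ X) (hb : b ∉ X) :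
    flagMinor x (insert a (insert b X)) =
      (-1) ^ (X.filter (· < a)).card * (-1) ^ (X.filter (· < b)).card *
      (Matrix.of (Matrix.vecCons (pathRow x (X.card + 2) a)
        (Matrix.vecCons (pathRow x (X.card + 2) b)
        fun i => pathRow x (X.card + 2) (X.orderEmbOfFin rfl i)))).det := by
  have h : (insert a (insert b X)).card = X.card + 2 := by
    rw [Finset.card_insert_of_notMem (by simp [hab.ne, ha]), Finset.card_insert_of_notMem hb]
  rw [flagMinor_eq x _ h]
  exact AlternatingMap.map_orderEmbOfFin_insert_insert Matrix.detRowAlternating (pathRow x _)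
    hab hb rfl h

theorem flagMinor_plucker_four {n : ℕ} (x : Fin n → ℕ → ℝ) {X : Finset (Fin n)} {i j k l : Fin n}
    (hij : i < j) (hjk : j < k) (hkl : k < l) (hi : i ∉ X) (hj : j ∉ X) (hk : k ∉ X) (hl : l ∉ X)
    (h : flagMinor x (insert i (insert k X)) ≠ 0) :
    flagMinor x (insert i (insert k X)) * flagMinor x (insert j (insert l X)) =
      flagMinor x (insert i (insert j X)) * flagMinor x (insert k (insert l X)) +
      flagMinor x (insert i (insert l X)) * flagMinor x (insert j (insert k X)) := by
  have hik := hij.trans hjk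
  have hjl := hjk.trans hkl
  rw [flagMinor_insert_insert x hik hi hk] at h ⊢
  rw [flagMinor_insert_insert x hjl hj hl, flagMinor_insert_insert x hij hi hj,
    flagMinor_insert_insert x hkl hk hl, flagMinor_insert_insert x (hij.trans hjl) hi hl,
    flagMinor_insert_insert x hjk hj hk]
  have key := Matrix.det_vecCons_vecCons_plucker _ _ (pathRow x (X.card + 2) j) _
    (pathRow x (X.card + 2) l) (right_ne_zero_of_mul h)
  linear_combination (-1) ^ (X.filter (· < i)).card * (-1) ^ (X.filter (· < j)).card *
    (-1) ^ (X.filter (· < k)).card * (-1) ^ (X.filter (· < l)).card * key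

/-- Expansion along the unit row. It lets a minor with one column fewer be treated as one of full
size. -/
theorem det_vecCons_vecCons_single {d : ℕ} (v : Fin (d + 2) → ℝ) (X : Fin d → Fin (d + 2) → ℝ) :
    (Matrix.of (Matrix.vecCons v (Matrix.vecCons (Pi.single (Fin.last _) 1) X))).det =
      (-1) ^ d * (Matrix.of (Matrix.vecCons (fun j : Fin (d + 1) => v j.castSucc)
        fun i (j : Fin (d + 1)) => X i j.castSucc)).det := by
  rw [Matrix.det_succ_row _ 1, Finset.sum_eq_single (Fin.last _)]
  · have : (Matrix.of (Matrix.vecCons v (Matrix.vecCons (Pi.single (Fin.last _) 1) X))).submatrix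
        (Fin.succAbove 1) (Fin.last (d + 1)).succAbove =
        Matrix.of (Matrix.vecCons (fun j : Fin (d + 1) => v j.castSucc)
        fun i (j : Fin (d + 1)) => X i j.castSucc) := by
      ext i j
      refine Fin.cases ?_ (fun i => ?_) i
      · simp
      · have : (1 : Fin (d + 2)).succAbove i.succ = i.succ.succ := by
          rw [← Fin.succ_zero_eq_one, Fin.succ_succAbove_succ, Fin.succAbove_zero]
        simp [this]
    rw [this]
    simp only [Matrix.of_apply, Matrix.cons_val_one, Matrix.cons_val_zero, Pi.single_eq_same,
      Fin.val_one, Fin.val_last, mul_one]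
    congr 1
    rw [show 1 + (d + 1) = d + 2 by ring, pow_add]; simp
  · intro j _ hj
    simp [hj]
  · simp

/-- This is the four-index relation with the last unit vector in the role of row `l`. Each product
contains it once, so the sign `(-1) ^ X.card` is common and cancels. -/
theorem flagMinor_plucker_three {n : ℕ} (x : Fin n → ℕ → ℝ) {X : Finset (Fin n)} {i j k : Fin n}
    (hij : i < j) (hjk : j < k) (hi : i ∉ X) (hj : j ∉ X) (hk : k ∉ X)
    (h : flagMinor x (insert i (insert k X)) ≠ 0) :
    flagMinor x (insert i (insert k X)) * flagMinor x (insert j X) =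
      flagMinor x (insert i (insert j X)) * flagMinor x (insert k X) +
      flagMinor x (insert i X) * flagMinor x (insert j (insert k X)) := by
  have hik := hij.trans hjk
  rw [flagMinor_insert_insert x hik hi hk] at h ⊢
  rw [flagMinor_insert_insert x hij hi hj, flagMinor_insert_insert x hjk hj hk,
    flagMinor_insert x hi, flagMinor_insert x hj, flagMinor_insert x hk]
  have key := Matrix.det_vecCons_vecCons_plucker _ _ (pathRow x (X.card + 2) j) _
    (Pi.single (Fin.last _) 1) (right_ne_zero_of_mul h)
  have e : ∀ p, (fun q : Fin (X.card + 1) => pathRow x (X.card + 2) p q.castSucc) =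
    pathRow x (X.card + 1) p := fun p => rfl
  have e' : (fun (i : Fin X.card) (q : Fin (X.card + 1)) =>
      pathRow x (X.card + 2) (X.orderEmbOfFin rfl i) q.castSucc) =
    fun i => pathRow x (X.card + 1) (X.orderEmbOfFin rfl i) := rfl
  simp only [det_vecCons_vecCons_single, e, e'] at key
  have hsign : ((-1 : ℝ) ^ X.card) ≠ 0 := by simp
  refine mul_left_cancel₀ hsign ?_
  linear_combination (-1) ^ (X.filter (· < i)).card * (-1) ^ (X.filter (· < j)).card *
    (-1) ^ (X.filter (· < k)).card * key

/-! ### Flow weights and their exponential sums. -/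

/-- The weights, with multiplicity, of the flows whose paths begin at the vertices `(s i, c)` and
end at the first `k` vertices of row `0` that lie in column `c` or to the right of it. -/
noncomputable def flowWeights {n : ℕ} (w : Fin n → ℕ → ℝ) :
    (k c : ℕ) → (Fin k → Fin n) → Multiset ℝ
  | 0, _, _ => {0}
  | k + 1, c, s => (interlacing s).val.bind fun r =>
      (flowWeights w k (c + 1) r).map fun a =>
        ((∑ t ∈ Finset.Iic (s 0), w t c) + ∑ j : Fin k, ∑ t ∈ Finset.Icc (r j) (s j.succ), w t c) + a

theorem sum_exp_flowWeights {n : ℕ} (w : Fin n → ℕ → ℝ) (θ : ℝ) :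
    ∀ (k c : ℕ) (s : Fin k → Fin n), StrictMono s →
      ((flowWeights w k c s).map fun a => Real.exp (θ * a)).sum =
        flowDet (fun t q => Real.exp (θ * w t q)) k c s
  | 0, c, s, _ => by simp [flowWeights, flowDet]
  | k + 1, c, s, hs => by
    rw [flowDet_succ _ _ _ _ hs, flowWeights, Multiset.map_bind, Multiset.sum_bind]
    refine Finset.sum_congr rfl fun r hr => ?_
    rw [← sum_exp_flowWeights w θ k (c + 1) r (strictMono_of_mem_interlacing hs hr),
      Multiset.map_map, ← Multiset.sum_map_mul_left]
    congr 1
    refine Multiset.map_congr rfl fun a _ => ?_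
    simp only [Function.comp_apply, mul_add, Real.exp_add, Finset.mul_sum, Real.exp_sum]

theorem flowWeights_ne_zero {n : ℕ} (w : Fin n → ℕ → ℝ) :
    ∀ (k c : ℕ) (s : Fin k → Fin n), StrictMono s → flowWeights w k c s ≠ 0
  | 0, c, s, _ => by simp [flowWeights]
  | k + 1, c, s, hs => by
    -- Every path but the first leaves the column at its beginning.
    have hr : (fun j : Fin k => s j.succ) ∈ interlacing s :=
      mem_interlacing.2 fun j => ⟨hs Fin.castSucc_lt_succ, le_rfl⟩
    obtain ⟨a, ha⟩ := Multiset.exists_mem_of_ne_zero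
      (flowWeights_ne_zero w k (c + 1) _ (strictMono_of_mem_interlacing hs hr))
    intro h
    have : _ ∈ flowWeights w (k + 1) c s :=
      Multiset.mem_bind.2 ⟨_, hr, Multiset.mem_map_of_mem _ ha⟩
    rw [h] at this
    exact Multiset.notMem_zero _ this

/-- If `∑ exp (θ u) ≤ ∑ exp (θ v)` for all `θ > 0`, then no `u` exceeds all the `v`. -/
theorem exists_le_of_sum_exp_le {U V : Multiset ℝ}
    (h : ∀ θ : ℝ, 0 < θ → (U.map fun u => Real.exp (θ * u)).sum ≤ (V.map fun v => Real.exp (θ * v)).sum)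
    {u : ℝ} (hu : u ∈ U) : ∃ v ∈ V, u ≤ v := by
  by_contra! hV
  -- `V` is finite, so the gap below `u` is uniform.
  obtain ⟨δ, hδ, hVδ⟩ : ∃ δ > 0, ∀ v ∈ V, v ≤ u - δ := by
    clear h hu
    induction V using Multiset.induction_on with
    | empty => exact ⟨1, one_pos, by simp⟩
    | cons a V ih =>
      obtain ⟨δ, hδ, hd⟩ := ih fun v hv => hV v (Multiset.mem_cons_of_mem hv)
      have ha := hV a (Multiset.mem_cons_self a V)
      refine ⟨min δ (u - a), lt_min hδ (by linarith), fun v hv => ?_⟩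
      rcases Multiset.mem_cons.1 hv with rfl | hv
      · linarith [min_le_right δ (u - v)]
      · linarith [min_le_left δ (u - a), hd v hv]
  -- Chosen so that `exp (θ * δ) ≥ θ * δ + 1 > V.card`: one term at `u` then outweighs all of `V`.
  set θ : ℝ := (V.card + 1) / δ
  have hθ : 0 < θ := by positivity
  have h1 : Real.exp (θ * u) ≤ (U.map fun u => Real.exp (θ * u)).sum :=
    Multiset.single_le_sum (fun x hx => by
      obtain ⟨y, _, rfl⟩ := Multiset.mem_map.1 hx; exact (Real.exp_pos _).le) _
      (Multiset.mem_map_of_mem _ hu)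
  have h2 : (V.map fun v => Real.exp (θ * v)).sum ≤ V.card * Real.exp (θ * (u - δ)) := by
    have := Multiset.sum_le_card_nsmul (V.map fun v => Real.exp (θ * v)) (Real.exp (θ * (u - δ)))
      (fun x hx => by
        obtain ⟨v, hv, rfl⟩ := Multiset.mem_map.1 hx
        exact Real.exp_le_exp.2 (mul_le_mul_of_nonneg_left (hVδ v hv) hθ.le))
    simpa using this
  have h3 : Real.exp (θ * u) = Real.exp (θ * δ) * Real.exp (θ * (u - δ)) := by
    rw [← Real.exp_add]; ring_nf
  have h4 := (h1.trans (h θ hθ)).trans h2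
  rw [h3] at h4
  have h5 := le_of_mul_le_mul_right h4 (Real.exp_pos _)
  have h6 : θ * δ = V.card + 1 := by simp only [θ]; field_simp
  have h7 := Real.add_one_le_exp (θ * δ)
  linarith

/-! ### Cutting and prolonging single paths at their first column. -/

/-- The weights of a matrix, extended by zero to all columns. -/
def extWeight {n m' : ℕ} (W : Matrix (Fin n) (Fin m') ℝ) (t : Fin n) (c : ℕ) : ℝ :=
  if h : c < m' then W t ⟨c, h⟩ else 0

@[simp]
theorem extWeight_val {n m' : ℕ} (W : Matrix (Fin n) (Fin m') ℝ) (t : Fin n) (c : Fin m') :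
    extWeight W t c = W t c := by simp [extWeight]

namespace GridPath

variable {n m' : ℕ}

theorem grid_adj (u v : Fin n × Fin m') : (grid n m').Adj u v ↔
    ((v.1 : ℕ) + 1 = u.1 ∧ v.2 = u.2) ∨ (v.1 = u.1 ∧ (v.2 : ℕ) = u.2 + 1) := Iff.rfl

theorem col_le_of_isChain : ∀ (l : List (Fin n × Fin m')) (u : Fin n × Fin m'),
    (u :: l).IsChain (grid n m').Adj → ∀ v ∈ u :: l, u.2 ≤ v.2
  | [], u, _, v, hv => by simp at hv; rw [hv]
  | u' :: l, u, h, v, hv => by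
    rw [List.isChain_cons_cons] at h
    rcases List.mem_cons.1 hv with rfl | hv
    · exact le_rfl
    · refine le_trans ?_ (col_le_of_isChain l u' h.2 v hv)
      rcases h.1 with h' | h'
      · exact h'.2.ge
      · rw [Fin.le_def]; omega

theorem first_mem (P : GridPath n m') : P.first ∈ P.verts := List.head_mem _

theorem last_mem (P : GridPath n m') : P.last ∈ P.verts := List.getLast_mem _

theorem col_first_le (P : GridPath n m') {v : Fin n × Fin m'} (hv : v ∈ P.verts) :
    P.first.2 ≤ v.2 := by
  obtain ⟨l, hl, hc⟩ := P
  cases l with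
  | nil => exact absurd rfl hl
  | cons u l => exact col_le_of_isChain l u hc v hv

/-- The path that consists of a single vertex. -/
def single (v : Fin n × Fin m') : GridPath n m' := ⟨[v], by simp, List.isChain_singleton v⟩

/-- The path obtained by putting a vertex in front. -/
def cons (v : Fin n × Fin m') (P : GridPath n m') (h : (grid n m').Adj v P.first) :
    GridPath n m' where
  verts := v :: P.verts
  ne_nil := by simp
  chain := P.chain.cons fun y hy => by
    rw [List.head?_eq_some_head P.ne_nil] at hy
    obtain rfl := Option.some_injective _ hy
    exact h

theorem first_cons (v : Fin n × Fin m') (P : GridPath n m') (h) : (cons v P h).first = v := rfl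

theorem last_cons (v : Fin n × Fin m') (P : GridPath n m') (h) : (cons v P h).last = P.last :=
  List.getLast_cons P.ne_nil

theorem weight_cons (W : Matrix (Fin n) (Fin m') ℝ) (v : Fin n × Fin m') (P : GridPath n m') (h) :
    (cons v P h).weight W = W v.1 v.2 + P.weight W := by
  simp [weight, cons]

theorem Icc_succ_eq_insert {r p q : Fin n} (hpq : (p : ℕ) + 1 = q) (hr : r ≤ p) :
    Finset.Icc r q = insert q (Finset.Icc r p) := by
  ext t
  simp only [Finset.mem_Icc, Finset.mem_insert, Fin.le_def, Fin.ext_iff] at *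
  omega

theorem sum_Icc_succ {r p q : Fin n} (hpq : (p : ℕ) + 1 = q) (hr : r ≤ p) (f : Fin n → ℝ) :
    ∑ t ∈ Finset.Icc r q, f t = f q + ∑ t ∈ Finset.Icc r p, f t := by
  rw [Icc_succ_eq_insert hpq hr, Finset.sum_insert]
  simp only [Finset.mem_Icc, Fin.le_def] at *
  omega

/-- A path runs through its first column and then leaves it, unless it ends there. -/
theorem exists_tail (W : Matrix (Fin n) (Fin m') ℝ) (P : GridPath n m') :
    ∃ r ≤ P.first.1, (∀ t, r ≤ t → t ≤ P.first.1 → (t, P.first.2) ∈ P.verts) ∧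
      ((P.last = (r, P.first.2) ∧
          P.weight W = ∑ t ∈ Finset.Icc r P.first.1, extWeight W t P.first.2) ∨
        ∃ Q : GridPath n m', Q.first.1 = r ∧ (Q.first.2 : ℕ) = P.first.2 + 1 ∧ Q.last = P.last ∧
          Q.verts ⊆ P.verts ∧
          P.weight W = (∑ t ∈ Finset.Icc r P.first.1, extWeight W t P.first.2) + Q.weight W) := by
  obtain ⟨l, hl, hc⟩ := P
  induction l with
  | nil => exact absurd rfl hl
  | cons u l ih =>
    simp only [extWeight_val] at ih ⊢
    cases l with
    | nil =>
      refine ⟨u.1, le_rfl, fun t h1 h2 => ?_, Or.inl ⟨rfl, ?_⟩⟩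
      · have : t = u.1 := le_antisymm h2 h1
        subst this
        exact List.mem_singleton.2 rfl
      · simp [weight, first]
    | cons v l =>
      have hc' := List.isChain_cons_cons.1 hc
      let P' : GridPath n m' := ⟨v :: l, by simp, hc'.2⟩
      have hadj : (grid n m').Adj u P'.first := hc'.1
      have hP : (⟨u :: v :: l, hl, hc⟩ : GridPath n m') = cons u P' hadj := rfl
      rw [hP]
      have hor := (grid_adj _ _).1 hc'.1
      rcases hor with ⟨h1, h2⟩ | ⟨h1, h2⟩
      · obtain ⟨r, hr, hmem, hrest⟩ := ih (by simp) hc'.2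
        have hru : r ≤ u.1 := by
          have : (r : ℕ) ≤ v.1 := hr
          rw [Fin.le_def]; omega
        change ∀ t, r ≤ t → t ≤ v.1 → (t, v.2) ∈ v :: l at hmem
        refine ⟨r, hru, fun t ht1 ht2 => ?_, ?_⟩
        · change t ≤ u.1 at ht2
          change (t, u.2) ∈ u :: v :: l
          rcases ht2.eq_or_lt with rfl | hlt
          · exact List.mem_cons_self
          · rw [← h2]
            refine List.mem_cons_of_mem _ (hmem t ht1 ?_)
            rw [Fin.lt_def] at hlt; rw [Fin.le_def]; omega
        · have hs : ∑ t ∈ Finset.Icc r u.1, W t u.2 =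
              W u.1 u.2 + ∑ t ∈ Finset.Icc r v.1, W t v.2 := by
            rw [sum_Icc_succ h1 hr, h2]
          rw [first_cons, weight_cons, last_cons, hs, ← h2]
          rcases hrest with ⟨ha, hb⟩ | ⟨Q, ha, hb, hc, hd, he⟩
          · exact Or.inl ⟨ha, congrArg _ hb⟩
          · refine Or.inr ⟨Q, ha, hb, hc, fun x hx => List.mem_cons_of_mem _ (hd hx), ?_⟩
            rw [add_assoc]; exact congrArg _ he
      -- The first edge goes to the next column, so the part in the first column is `u` alone.
      · refine ⟨u.1, le_rfl, fun t ht1 ht2 => ?_, Or.inr ⟨P', h1, h2, ?_, ?_, ?_⟩⟩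
        · have : t = u.1 := le_antisymm ht2 ht1
          subst this
          exact List.mem_cons_self
        · rw [last_cons]
        · exact fun x hx => List.mem_cons_of_mem _ hx
        · rw [weight_cons, first_cons, Finset.Icc_self, Finset.sum_singleton]

/-- A path can be prolonged backwards inside its first column. -/
theorem exists_climb (W : Matrix (Fin n) (Fin m') ℝ) {r p : Fin n} (hrp : r ≤ p) {c : Fin m'}
    (P : GridPath n m') (hP : P.first = (r, c)) :
    ∃ Q : GridPath n m', Q.first = (p, c) ∧ Q.last = P.last ∧
      (∀ v ∈ Q.verts, (v.2 = c ∧ r ≤ v.1 ∧ v.1 ≤ p) ∨ v ∈ P.verts) ∧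
      Q.weight W + W r c = (∑ t ∈ Finset.Icc r p, W t c) + P.weight W := by
  obtain ⟨p, hp⟩ := p
  induction p with
  | zero =>
    obtain rfl : r = ⟨0, hp⟩ := le_antisymm hrp (by simp [Fin.le_def])
    exact ⟨P, hP, rfl, fun v hv => Or.inr hv, by simp [add_comm]⟩
  | succ p ih =>
    rcases hrp.eq_or_lt with h | h
    · exact ⟨P, by rw [hP, h], rfl, fun v hv => Or.inr hv, by rw [← h]; simp [add_comm]⟩
    · have h' : r ≤ ⟨p, by omega⟩ := by rw [Fin.lt_def] at h; rw [Fin.le_def]; simp at h ⊢; omega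
      obtain ⟨Q, h1, h2, h3, h4⟩ := ih (by omega) h'
      have hadj : (grid n m').Adj (⟨p + 1, hp⟩, c) Q.first := by simp [grid_adj, h1]
      refine ⟨cons (⟨p + 1, hp⟩, c) Q hadj, rfl,
        (last_cons _ _ _).trans h2, fun v hv => ?_, ?_⟩
      · rcases List.mem_cons.1 hv with rfl | hv
        · exact Or.inl ⟨rfl, hrp, le_rfl⟩
        · refine (h3 v hv).imp_left fun h => ⟨h.1, h.2.1, h.2.2.trans ?_⟩
          simp [Fin.le_def]
      · rw [weight_cons, sum_Icc_succ rfl h', add_assoc, h4, add_assoc]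

theorem exists_column (W : Matrix (Fin n) (Fin m') ℝ) {r p : Fin n} (hrp : r ≤ p) (c : Fin m') :
    ∃ Q : GridPath n m', Q.first = (p, c) ∧ Q.last = (r, c) ∧
      (∀ v ∈ Q.verts, v.2 = c ∧ r ≤ v.1 ∧ v.1 ≤ p) ∧
      Q.weight W = ∑ t ∈ Finset.Icc r p, W t c := by
  obtain ⟨Q, h1, h2, h3, h4⟩ := exists_climb W hrp (single (r, c)) rfl
  refine ⟨Q, h1, h2, fun v hv => (h3 v hv).elim id fun h => ?_, ?_⟩
  · obtain rfl := List.mem_singleton.1 h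
    exact ⟨rfl, le_rfl, hrp⟩
  · simpa [weight, single] using h4

/-- Inverse of the cut in `exists_tail`: enter `P` from `(r, c)`, then climb backwards with
`exists_climb`. -/
theorem exists_prolong (W : Matrix (Fin n) (Fin m') ℝ) {r p : Fin n} (hrp : r ≤ p) (c : Fin m')
    (P : GridPath n m') (h1 : P.first.1 = r) (h2 : (P.first.2 : ℕ) = c + 1) :
    ∃ Q : GridPath n m', Q.first = (p, c) ∧ Q.last = P.last ∧
      (∀ v ∈ Q.verts, (v.2 = c ∧ r ≤ v.1 ∧ v.1 ≤ p) ∨ v ∈ P.verts) ∧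
      Q.weight W = (∑ t ∈ Finset.Icc r p, W t c) + P.weight W := by
  have hadj : (grid n m').Adj (r, c) P.first := by simp [grid_adj, h1, h2]
  obtain ⟨Q, h1, h2, h3, h4⟩ := exists_climb W hrp (cons (r, c) P hadj) rfl
  refine ⟨Q, h1, h2.trans (last_cons _ _ _), fun v hv => (h3 v hv).elim Or.inl fun h => ?_, ?_⟩
  · rcases List.mem_cons.1 h with rfl | h
    · exact Or.inl ⟨rfl, le_rfl, hrp⟩
    · exact Or.inr h
  · rw [weight_cons] at h4
    linarith

end GridPath

/-! ### Families of disjoint paths: removing and adding a column. -/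

/-- A family of pairwise disjoint paths that begin at the vertices `(s i, c)` and end at the first
`k` vertices of row `0` that lie in column `c` or to the right of it. -/
structure IsPathFamily {n m' : ℕ} (k c : ℕ) (s : Fin k → Fin n) (P : Fin k → GridPath n m') :
    Prop where
  first_row : ∀ i, (P i).first.1 = s i
  first_col : ∀ i, ((P i).first.2 : ℕ) = c
  last_row : ∀ i, ((P i).last.1 : ℕ) = 0
  last_col : ∀ i, ((P i).last.2 : ℕ) < c + k
  disjoint : ∀ i j, i ≠ j → (P i).verts.Disjoint (P j).verts

namespace IsPathFamily

variable {n m' k c : ℕ}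

theorem injective {s : Fin k → Fin n} {P : Fin k → GridPath n m'} (h : IsPathFamily k c s P) :
    Function.Injective P := by
  intro i j hij
  by_contra hne
  exact h.disjoint i j hne (P i).first_mem (hij ▸ (P i).first_mem)

theorem last_injective {s : Fin k → Fin n} {P : Fin k → GridPath n m'} (h : IsPathFamily k c s P) :
    Function.Injective fun i => (P i).last := by
  intro i j hij
  by_contra hne
  exact h.disjoint i j hne (P i).last_mem
    (by have := (P j).last_mem; rwa [← show (P i).last = (P j).last from hij] at this)

theorem le_last_col {s : Fin k → Fin n} {P : Fin k → GridPath n m'} (h : IsPathFamily k c s P)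
    (i : Fin k) : c ≤ (P i).last.2 := by
  rw [← h.first_col i]
  exact (P i).col_first_le (P i).last_mem

/-- Pigeonhole: disjoint paths have `k` distinct ends among `k` available sinks. -/
theorem exists_last {s : Fin k → Fin n} {P : Fin k → GridPath n m'} (h : IsPathFamily k c s P)
    {q : ℕ} (hq : c ≤ q) (hqk : q < c + k) : ∃ i, ((P i).last.2 : ℕ) = q := by
  let g : Fin k → Fin k := fun i => ⟨(P i).last.2 - c, by
    have := h.last_col i; have := h.le_last_col i; omega⟩
  have hg : Function.Injective g := by
    intro i j hij
    apply h.last_injective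
    have h1 := h.le_last_col i
    have h2 := h.le_last_col j
    have h3 : ((P i).last.2 : ℕ) - c = (P j).last.2 - c := congrArg Fin.val hij
    refine Prod.ext (Fin.ext ?_) (Fin.ext ?_)
    · rw [h.last_row, h.last_row]
    · change ((P i).last.2 : ℕ) = (P j).last.2
      omega
  obtain ⟨i, hi⟩ := (Finite.injective_iff_surjective.1 hg) ⟨q - c, by omega⟩
  refine ⟨i, ?_⟩
  have h1 := h.le_last_col i
  have h3 : ((P i).last.2 : ℕ) - c = q - c := congrArg Fin.val hi
  omega

/-- Removing the first column from a family of disjoint paths. -/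
theorem exists_peel (W : Matrix (Fin n) (Fin m') ℝ) {s : Fin (k + 1) → Fin n} (hs : StrictMono s)
    {P : Fin (k + 1) → GridPath n m'} (h : IsPathFamily (k + 1) c s P) :
    ∃ r ∈ interlacing s, ∃ Q, IsPathFamily k (c + 1) r Q ∧
      ∑ i, (P i).weight W =
        ((∑ t ∈ Finset.Iic (s 0), extWeight W t c) +
          ∑ j : Fin k, ∑ t ∈ Finset.Icc (r j) (s j.succ), extWeight W t c) +
        ∑ j, (Q j).weight W := by
  choose r hr hmem hrest using fun i => (P i).exists_tail W
  simp only [h.first_row, h.first_col] at hr hmem hrest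
  -- Otherwise path `j`, climbing column `c` from `s j` to `r j`, would run through the beginning of
  -- path `i`.
  have hlt : ∀ i j, i < j → s i < r j := by
    intro i j hij
    by_contra! hle
    refine h.disjoint i j hij.ne (P i).first_mem ?_
    have h1 := hmem j (s i) hle (hs.monotone hij.le)
    have h2 : (P i).first = (s i, (P j).first.2) :=
      Prod.ext (h.first_row i) (Fin.ext (by rw [h.first_col]; exact (h.first_col j).symm))
    rwa [h2]
  have hcol : ∀ i, ((P i).last.2 : ℕ) = c → ((P i).last = (r i, (P i).first.2)) ∧
      (P i).weight W = ∑ t ∈ Finset.Icc (r i) (s i), extWeight W t c := by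
    intro i hi
    refine (hrest i).resolve_right ?_
    rintro ⟨Q, h1, h2, h3, -⟩
    have h4 : Q.first.2 ≤ Q.last.2 := Q.col_first_le Q.last_mem
    rw [h3, Fin.le_def] at h4
    omega
  -- Some path ends at the sink of column `c`, hence stays in that column up to row `0`. It must be
  -- path `0`, as the others have exit rows beyond `s 0`.
  have hlast0 : ((P 0).last.2 : ℕ) = c := by
    obtain ⟨i, hi⟩ := h.exists_last (q := c) le_rfl (by omega)
    rcases Fin.eq_zero_or_eq_succ i with rfl | ⟨j, rfl⟩
    · exact hi
    · have h1 := (hcol _ hi).1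
      have h2 := h.last_row j.succ
      rw [h1] at h2
      have h3 := hlt 0 j.succ (Fin.succ_pos j)
      rw [Fin.lt_def] at h3
      simp only at h2
      omega
  -- The sink of column `c` is taken by path `0`, so every other path leaves the column.
  have hQ : ∀ j : Fin k, ∃ Q : GridPath n m', Q.first.1 = r j.succ ∧ (Q.first.2 : ℕ) = c + 1 ∧
      Q.last = (P j.succ).last ∧ Q.verts ⊆ (P j.succ).verts ∧
      (P j.succ).weight W =
        (∑ t ∈ Finset.Icc (r j.succ) (s j.succ), extWeight W t c) + Q.weight W := by
    intro j
    refine (hrest j.succ).resolve_left ?_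
    rintro ⟨h1, -⟩
    have h2 : (P j.succ).last = (P 0).last := by
      refine Prod.ext (Fin.ext ?_) (Fin.ext ?_)
      · rw [h.last_row, h.last_row]
      · rw [hlast0, h1]; exact h.first_col _
    exact Fin.succ_ne_zero j (h.last_injective h2)
  choose Q hQ1 hQ2 hQ3 hQ4 hQ5 using hQ
  refine ⟨fun j => r j.succ, mem_interlacing.2 fun j =>
    ⟨hlt _ _ Fin.castSucc_lt_succ, hr j.succ⟩, Q, ⟨hQ1, hQ2, fun j => ?_, fun j => ?_, ?_⟩, ?_⟩
  · rw [hQ3]; exact h.last_row _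
  · rw [hQ3]; have := h.last_col j.succ; omega
  · intro i j hij
    exact (List.disjoint_of_subset_left (hQ4 i) (List.disjoint_of_subset_right (hQ4 j)
      (h.disjoint _ _ fun e => hij (Fin.succ_injective _ e))))
  · rw [Fin.sum_univ_succ, (hcol 0 hlast0).2, Finset.sum_congr rfl fun j _ => hQ5 j,
      Finset.sum_add_distrib, add_assoc]
    congr 2
    ext t
    have h2 := h.last_row 0
    rw [(hcol 0 hlast0).1] at h2
    simp only [Finset.mem_Icc, Finset.mem_Iic, Fin.le_def] at *
    omega

/-- Adding a first column to a family of disjoint paths. -/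
theorem exists_unpeel (W : Matrix (Fin n) (Fin m') ℝ) {s : Fin (k + 1) → Fin n}
    (hs : StrictMono s) (hc : c < m') {r : Fin k → Fin n} (hr : r ∈ interlacing s)
    {Q : Fin k → GridPath n m'} (h : IsPathFamily k (c + 1) r Q) :
    ∃ P, IsPathFamily (k + 1) c s P ∧
      ∑ i, (P i).weight W =
        ((∑ t ∈ Finset.Iic (s 0), extWeight W t c) +
          ∑ j : Fin k, ∑ t ∈ Finset.Icc (r j) (s j.succ), extWeight W t c) +
        ∑ j, (Q j).weight W := by
  rw [mem_interlacing] at hr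
  obtain ⟨c, rfl⟩ : ∃ c' : Fin m', (c' : ℕ) = c := ⟨⟨c, hc⟩, rfl⟩
  let o : Fin n := ⟨0, (s 0).pos⟩
  have ho : ∀ t, o ≤ t := fun t => by simp [o, Fin.le_def]
  obtain ⟨P₀, h1, h2, h3, h4⟩ := GridPath.exists_column W (ho (s 0)) c
  choose P hP1 hP2 hP3 hP4 using fun j =>
    GridPath.exists_prolong W (hr j).2 c (Q j) (h.first_row j) (h.first_col j)
  have hfirst : ∀ i : Fin (k + 1),
      ((Fin.cons P₀ P : Fin (k + 1) → GridPath n m') i).first = (s i, c) :=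
    fun i => Fin.cases h1 hP1 i
  have hQcol : ∀ j, ∀ v ∈ (Q j).verts, v.2 ≠ c := by
    intro j v hv hvc
    have h1 := (Q j).col_first_le hv
    rw [Fin.le_def, h.first_col, hvc] at h1
    omega
  -- Interlacing separates the segments in column `c`; the rest lies to the right, where the `Q j`
  -- are disjoint.
  have hltP : ∀ i j, i < j → ∀ v ∈ (P i).verts, v ∉ (P j).verts := by
    intro i j hij v hv hv'
    rcases hP3 i v hv with h1 | h1 <;> rcases hP3 j v hv' with h2 | h2
    · have : s i.succ ≤ s j.castSucc := hs.monotone (by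
        rw [Fin.le_def]; simpa using Nat.succ_le_of_lt (Fin.lt_def.1 hij))
      exact absurd ((h1.2.2.trans this).trans_lt (hr j).1) (not_lt.2 h2.2.1)
    · exact hQcol _ _ h2 h1.1
    · exact hQcol _ _ h1 h2.1
    · exact h.disjoint i j hij.ne h1 h2
  have hlt0 : ∀ j, ∀ v ∈ P₀.verts, v ∉ (P j).verts := by
    intro j v hv hv'
    have h1 := h3 v hv
    rcases hP3 j v hv' with h2 | h2
    · have : s 0 ≤ s j.castSucc := hs.monotone (Fin.zero_le _)
      exact absurd ((h1.2.2.trans this).trans_lt (hr j).1) (not_lt.2 h2.2.1)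
    · exact hQcol _ _ h2 h1.1
  refine ⟨Fin.cons P₀ P, ⟨fun i => by rw [hfirst], fun i => by rw [hfirst], fun i => ?_,
    fun i => ?_, fun i j hij v hv hv' => ?_⟩, ?_⟩
  · refine Fin.cases ?_ (fun j => ?_) i
    · simp [h2, o]
    · simpa [hP2] using h.last_row j
  · refine Fin.cases ?_ (fun j => ?_) i
    · simp [h2]
    · have := h.last_col j
      simp only [Fin.cons_succ, hP2]
      omega
  · induction i using Fin.cases with
    | zero =>
      induction j using Fin.cases with
      | zero => exact hij rfl
      | succ j => exact hlt0 j v hv hv'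
    | succ i =>
      induction j using Fin.cases with
      | zero => exact hlt0 i v hv' hv
      | succ j =>
        rcases lt_trichotomy i j with h' | rfl | h'
        · exact hltP i j h' v hv hv'
        · exact hij rfl
        · exact hltP j i h' v hv' hv
  · rw [Fin.sum_univ_succ]
    simp only [Fin.cons_zero, Fin.cons_succ, hP4, h4, Finset.sum_add_distrib, extWeight_val]
    rw [add_assoc]
    congr 2
    ext t
    simp [ho t]

end IsPathFamily

/-! ### Admissible flows and the recursion for their weights. -/

/-- Peeling and unpeeling a column realise the recursion. The bound `c + k ≤ m'` keeps it within the
columns of `W`, away from the extension by zero. -/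
theorem mem_flowWeights {n m' : ℕ} (W : Matrix (Fin n) (Fin m') ℝ) :
    ∀ (k c : ℕ) (s : Fin k → Fin n), StrictMono s → c + k ≤ m' → ∀ a : ℝ,
      a ∈ flowWeights (extWeight W) k c s ↔
        ∃ P : Fin k → GridPath n m', IsPathFamily k c s P ∧ ∑ i, (P i).weight W = a
  | 0, c, s, _, _, a => by
    simp only [flowWeights, Multiset.mem_singleton, Finset.univ_eq_empty, Finset.sum_empty]
    refine ⟨fun h => ⟨Fin.elim0, ⟨?_, ?_, ?_, ?_, ?_⟩, h.symm⟩, fun ⟨_, _, h⟩ => h.symm⟩ <;>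
      exact fun i => i.elim0
  | k + 1, c, s, hs, hc, a => by
    simp only [flowWeights, Multiset.mem_bind, Multiset.mem_map, Finset.mem_val]
    constructor
    · rintro ⟨r, hr, b, hb, rfl⟩
      obtain ⟨Q, hQ, rfl⟩ := (mem_flowWeights W k (c + 1) r
        (strictMono_of_mem_interlacing hs hr) (by omega) b).1 hb
      exact hQ.exists_unpeel W hs (by omega) hr
    · rintro ⟨P, hP, rfl⟩
      obtain ⟨r, hr, Q, hQ, h⟩ := hP.exists_peel W hs
      exact ⟨r, hr, _, (mem_flowWeights W k (c + 1) r
        (strictMono_of_mem_interlacing hs hr) (by omega) _).2 ⟨Q, hQ, rfl⟩, h.symm⟩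

/-- Disjoint paths have distinct beginnings, so a flow from `S` has `|S|` paths and can be indexed
by the increasing enumeration of `S`. -/
theorem mem_admissibleWeights_iff {n m' : ℕ} (W : Matrix (Fin n) (Fin m') ℝ) (S : Finset (Fin n))
    (hS : S.card ≤ m') (a : ℝ) :
    a ∈ admissibleWeights W S ↔
      a ∈ flowWeights (extWeight W) S.card 0 (S.orderEmbOfFin rfl) := by
  classical
  rw [mem_flowWeights W _ _ _ (S.orderEmbOfFin rfl).strictMono (by omega)]
  constructor
  · rintro ⟨F, hF, hb, rfl⟩
    have hfirst : ∀ P ∈ F, IsSource P.first ∧ P.first.1 ∈ S := fun P hP => by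
      have : P.first ∈ GridPath.first '' (F : Set (GridPath n m')) := ⟨P, hP, rfl⟩
      rwa [hb] at this
    have hsource : ∀ p ∈ S, ∃ P ∈ F, P.first.1 = p := by
      intro p hp
      have h0 : 0 < m' := (Finset.card_pos.2 ⟨p, hp⟩).trans_le hS
      have : ((p, ⟨0, h0⟩) : Fin n × Fin m') ∈ GridPath.first '' (F : Set (GridPath n m')) := by
        rw [hb]; exact ⟨rfl, hp⟩
      obtain ⟨P, hP, h⟩ := this
      exact ⟨P, hP, by rw [h]⟩
    have hinj : ∀ P ∈ F, ∀ Q ∈ F, P.first.1 = Q.first.1 → P = Q := by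
      intro P hP Q hQ h
      by_contra hne
      have h1 : P.first = Q.first :=
        Prod.ext h (Fin.ext ((hfirst P hP).1.trans (hfirst Q hQ).1.symm))
      exact hF.disjoint P hP Q hQ hne P.first_mem (h1 ▸ Q.first_mem)
    have hcard : F.card = S.card := Finset.card_bij (fun P _ => P.first.1)
      (fun P hP => (hfirst P hP).2) (fun P hP Q hQ h => hinj P hP Q hQ h)
      (fun p hp => by simpa using hsource p hp)
    have hex : ∀ i : Fin S.card, ∃ P ∈ F, P.first.1 = S.orderEmbOfFin rfl i :=
      fun i => hsource _ (Finset.orderEmbOfFin_mem S rfl i)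
    choose P hPF hP1 using hex
    have hPinj : Function.Injective P := fun i j hij =>
      (S.orderEmbOfFin rfl).injective (by rw [← hP1, ← hP1, hij])
    have himage : Finset.univ.image P = F := by
      refine Finset.eq_of_subset_of_card_le (fun Q hQ => ?_) ?_
      · obtain ⟨i, -, rfl⟩ := Finset.mem_image.1 hQ; exact hPF i
      · rw [Finset.card_image_of_injective _ hPinj, hcard]; simp
    refine ⟨P, ⟨hP1, fun i => (hfirst _ (hPF i)).1, fun i => (hF.flow _ (hPF i)).2, fun i => ?_,
      fun i j hij => hF.disjoint _ (hPF i) _ (hPF j) fun h => hij (hPinj h)⟩, ?_⟩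
    · have : (P i).last ∈ GridPath.last '' (F : Set (GridPath n m')) := ⟨P i, hPF i, rfl⟩
      rw [hF.sinks, hcard] at this
      simpa using this.2
    · rw [flowWeight, ← himage, Finset.sum_image fun i _ j _ h => hPinj h]
  · rintro ⟨P, hP, rfl⟩
    have hcard : (Finset.univ.image P).card = S.card := by
      rw [Finset.card_image_of_injective _ hP.injective]; simp
    have hcoe : ((Finset.univ.image P : Finset (GridPath n m')) : Set (GridPath n m')) =
        Set.range P := by simp
    refine ⟨Finset.univ.image P, ⟨?_, ?_, ?_⟩, ?_, ?_⟩
    · intro Q hQ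
      obtain ⟨i, -, rfl⟩ := Finset.mem_image.1 hQ
      exact ⟨hP.first_col i, hP.last_row i⟩
    · intro Q hQ R hR hne
      obtain ⟨i, -, rfl⟩ := Finset.mem_image.1 hQ
      obtain ⟨j, -, rfl⟩ := Finset.mem_image.1 hR
      exact hP.disjoint i j fun h => hne (by rw [h])
    · rw [hcoe, hcard]
      ext v
      constructor
      · rintro ⟨_, ⟨i, rfl⟩, rfl⟩
        exact ⟨hP.last_row i, by simpa using hP.last_col i⟩
      · rintro ⟨h1, h2⟩
        obtain ⟨i, hi⟩ := hP.exists_last (q := v.2) (Nat.zero_le _) (by simpa using h2)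
        exact ⟨P i, ⟨i, rfl⟩, Prod.ext (Fin.ext ((hP.last_row i).trans h1.symm)) (Fin.ext hi)⟩
    · rw [BeginsAt, hcoe]
      ext v
      constructor
      · rintro ⟨_, ⟨i, rfl⟩, rfl⟩
        exact ⟨hP.first_col i, by rw [hP.first_row]; exact Finset.orderEmbOfFin_mem S rfl i⟩
      · rintro ⟨h1, h2⟩
        obtain ⟨i, hi⟩ : v.1 ∈ Set.range (S.orderEmbOfFin rfl) := by
          rw [Finset.range_orderEmbOfFin]; exact h2
        exact ⟨P i, ⟨i, rfl⟩, Prod.ext ((hP.first_row i).trans hi)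
          (Fin.ext ((hP.first_col i).trans h1.symm))⟩
    · rw [flowWeight, Finset.sum_image fun i _ j _ h => hP.injective h]

theorem isGreatest_flowFunction {n m' : ℕ} (W : Matrix (Fin n) (Fin m') ℝ) (S : Finset (Fin n))
    (hS : S.card ≤ m') : IsGreatest (admissibleWeights W S) (flowFunction W S) := by
  have hset : admissibleWeights W S =
      {a | a ∈ flowWeights (extWeight W) S.card 0 (S.orderEmbOfFin rfl)} :=
    Set.ext (mem_admissibleWeights_iff W S hS)
  have hfin : (admissibleWeights W S).Finite := by
    rw [hset]; exact Multiset.finite_toSet _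
  have hne : (admissibleWeights W S).Nonempty := by
    rw [hset]
    exact Multiset.exists_mem_of_ne_zero
      (flowWeights_ne_zero _ _ _ _ (S.orderEmbOfFin rfl).strictMono)
  exact ⟨hne.csSup_mem hfin, fun a ha => le_csSup hfin.bddAbove ha⟩

/-! ### Passage from the Plücker relations to their tropical form. -/

/-- The sum of `exp (θ a)` over the weights `a` of the admissible flows from `S`. -/
noncomputable def flowExpSum {n m' : ℕ} (W : Matrix (Fin n) (Fin m') ℝ) (θ : ℝ)
    (S : Finset (Fin n)) : ℝ :=
  flagMinor (fun t q => Real.exp (θ * extWeight W t q)) S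

theorem flowExpSum_eq {n m' : ℕ} (W : Matrix (Fin n) (Fin m') ℝ) (θ : ℝ) (S : Finset (Fin n)) :
    flowExpSum W θ S = ((flowWeights (extWeight W) S.card 0 (S.orderEmbOfFin rfl)).map
      fun a => Real.exp (θ * a)).sum :=
  (sum_exp_flowWeights _ θ _ _ _ (S.orderEmbOfFin rfl).strictMono).symm

/-- Provides the nonvanishing minor that the Plücker relations require. -/
theorem flowExpSum_pos {n m' : ℕ} (W : Matrix (Fin n) (Fin m') ℝ) (θ : ℝ) (S : Finset (Fin n)) :
    0 < flowExpSum W θ S := by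
  obtain ⟨a, ha⟩ := Multiset.exists_mem_of_ne_zero
    (flowWeights_ne_zero (extWeight W) _ 0 _ (S.orderEmbOfFin rfl).strictMono)
  rw [flowExpSum_eq]
  refine (Real.exp_pos (θ * a)).trans_le (Multiset.single_le_sum (fun x hx => ?_) _
    (Multiset.mem_map_of_mem _ ha))
  obtain ⟨y, _, rfl⟩ := Multiset.mem_map.1 hx
  exact (Real.exp_pos _).le

theorem Multiset.sum_map_exp_product (θ : ℝ) (U V : Multiset ℝ) :
    (((U ×ˢ V).map fun p => p.1 + p.2).map fun u => Real.exp (θ * u)).sum =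
      (U.map fun u => Real.exp (θ * u)).sum * (V.map fun v => Real.exp (θ * v)).sum := by
  change (((U.bind fun a => V.map (Prod.mk a)).map _).map _).sum = _
  rw [Multiset.map_map, Multiset.map_bind, Multiset.sum_bind]
  simp only [Multiset.map_map, Function.comp_def, mul_add, Real.exp_add, Multiset.sum_map_mul_left,
    Multiset.sum_map_mul_right]

/-- Both sides of `h` are exponential sums over multisets of weights of pairs of flows. Equal sums
for all `θ > 0` force equal largest elements, and these are the two sides of the conclusion. -/
theorem flowFunction_add_eq_max {n m' : ℕ} (W : Matrix (Fin n) (Fin m') ℝ)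
    {A₁ A₂ B₁ B₂ C₁ C₂ : Finset (Fin n)} (hA₁ : A₁.card ≤ m') (hA₂ : A₂.card ≤ m')
    (hB₁ : B₁.card ≤ m') (hB₂ : B₂.card ≤ m') (hC₁ : C₁.card ≤ m') (hC₂ : C₂.card ≤ m')
    (h : ∀ θ, flowExpSum W θ A₁ * flowExpSum W θ A₂ =
      flowExpSum W θ B₁ * flowExpSum W θ B₂ + flowExpSum W θ C₁ * flowExpSum W θ C₂) :
    flowFunction W A₁ + flowFunction W A₂ =
      max (flowFunction W B₁ + flowFunction W B₂) (flowFunction W C₁ + flowFunction W C₂) := by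
  let w : Finset (Fin n) → Multiset ℝ := fun S =>
    flowWeights (extWeight W) S.card 0 (S.orderEmbOfFin rfl)
  have hmem : ∀ {S : Finset (Fin n)}, S.card ≤ m' → flowFunction W S ∈ w S := fun {S} hS =>
    (mem_admissibleWeights_iff W S hS _).1 (isGreatest_flowFunction W S hS).1
  have hle : ∀ {S : Finset (Fin n)}, S.card ≤ m' → ∀ a ∈ w S, a ≤ flowFunction W S :=
    fun {S} hS a ha => (isGreatest_flowFunction W S hS).2 ((mem_admissibleWeights_iff W S hS a).2 ha)
  let pr : Finset (Fin n) → Finset (Fin n) → Multiset ℝ := fun S T =>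
    (w S ×ˢ w T).map fun p => p.1 + p.2
  have hpr : ∀ {S T : Finset (Fin n)}, S.card ≤ m' → T.card ≤ m' →
      flowFunction W S + flowFunction W T ∈ pr S T := fun {S T} hS hT =>
    Multiset.mem_map.2 ⟨(flowFunction W S, flowFunction W T),
      Multiset.mem_product.2 ⟨hmem hS, hmem hT⟩, rfl⟩
  have hprle : ∀ {S T : Finset (Fin n)}, S.card ≤ m' → T.card ≤ m' → ∀ a ∈ pr S T,
      a ≤ flowFunction W S + flowFunction W T := by
    intro S T hS hT a ha
    obtain ⟨p, hp, rfl⟩ := Multiset.mem_map.1 ha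
    rw [Multiset.mem_product] at hp
    exact add_le_add (hle hS _ hp.1) (hle hT _ hp.2)
  have hsum : ∀ θ, ((pr A₁ A₂).map fun u => Real.exp (θ * u)).sum =
      ((pr B₁ B₂ + pr C₁ C₂).map fun u => Real.exp (θ * u)).sum := by
    intro θ
    rw [Multiset.map_add, Multiset.sum_add]
    simp only [pr, Multiset.sum_map_exp_product]
    simpa only [flowExpSum_eq] using h θ
  apply le_antisymm
  · obtain ⟨v, hv, hle'⟩ := exists_le_of_sum_exp_le (fun θ _ => (hsum θ).le) (hpr hA₁ hA₂)
    rcases Multiset.mem_add.1 hv with hv | hv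
    · exact le_max_of_le_left (hle'.trans (hprle hB₁ hB₂ v hv))
    · exact le_max_of_le_right (hle'.trans (hprle hC₁ hC₂ v hv))
  · have key : ∀ u ∈ pr B₁ B₂ + pr C₁ C₂, u ≤ flowFunction W A₁ + flowFunction W A₂ := by
      intro u hu
      obtain ⟨v, hv, hle'⟩ := exists_le_of_sum_exp_le (fun θ _ => (hsum θ).ge) hu
      exact hle'.trans (hprle hA₁ hA₂ v hv)
    exact max_le (key _ (Multiset.mem_add.2 (Or.inl (hpr hB₁ hB₂))))
      (key _ (Multiset.mem_add.2 (Or.inr (hpr hC₁ hC₂))))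

theorem mainTheorem2 (n m m' : ℕ) (hm : m ≤ m') (hm' : m' ≤ n)
    (W : Matrix (Fin n) (Fin m') ℝ) :
    (∀ S : Finset (Fin n), S.card ≤ m' →
      IsGreatest (admissibleWeights W S) (flowFunction W S)) ∧
    flowFunction W ∅ = 0 ∧
    IsTropicalPluckerOn (truncatedCube n m m') (flowFunction W) := by
  refine ⟨fun S hS => isGreatest_flowFunction W S hS, ?_, ⟨?_, ?_⟩⟩
  · have h := (mem_admissibleWeights_iff W ∅ (by simp) _).1
      (isGreatest_flowFunction W ∅ (by simp)).1
    exact Multiset.mem_singleton.1 h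
  · intro X i j k hij hjk hi hj hk h1 h2 h3 h4 h5 h6
    exact flowFunction_add_eq_max W h1.2 h2.2 h3.2 h4.2 h5.2 h6.2 fun θ =>
      flagMinor_plucker_three _ hij hjk hi hj hk (flowExpSum_pos W θ _).ne'
  · intro X i j k l hij hjk hkl hi hj hk hl h1 h2 h3 h4 h5 h6
    exact flowFunction_add_eq_max W h1.2 h2.2 h3.2 h4.2 h5.2 h6.2 fun θ =>
      flagMinor_plucker_four _ hij hjk hkl hi hj hk hl (flowExpSum_pos W θ _).ne'
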